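/- \textbf{Proposition.} For $n\ge 0$ let $S_n$ be the symmetric group and, for $1\le i\le n$, let $J_i=\sum_{j<i}(j\ i)\in\mathbb{Z}[S_n]$ be the Jucys--Murphy elements (they commute with each other). For a partition $\lambda$ of $n$ let $\mathcal{C}_\lambda\in\mathbb{Z}[S_n]$ be the sum of all permutations of cycle type $\lambda$. Let $F$ be a symmetric function with integer coefficients (in infinitely many variables), of degree at most $k$, where $k\ge 0$ is an integer. Then there are unique integers $a^F_\lambda$, indexed by all partitions $\lambda$, such that for every $n\ge 0$ \[F(J_1,\dots,J_n)=\sum_{\lambda\vdash n}a^F_\lambda\,\mathcal{C}_\lambda ,\] where $F(J_1,\dots,J_n)$ is obtained by replacing the first $n$ variables of $F$ by $J_1,\dots,J_n$ and the others by $0$. Moreover, for every partition $\rho$, of size $|\rho|$ and with $\ell(\rho)$ parts, the function $t\mapsto a^F_{\rho\cup 1^t}$ on the integers $t\ge 0$, where $\rho\cup 1^t$ is obtained from $\rho$ by adding $t$ parts equal to $1$, is a polynomial in $t$ (with rational coefficients) of degree at most \[k-(|\rho|-\ell(\rho)),\] where the zero polynomial is the only one allowed if this bound is negative. -/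

import Mathlib

/-- A power series `F` over `ℤ` in the variables `x₀, x₁, x₂, …` is a *symmetric function* if it is
invariant under all permutations of the variables and its degree is bounded. -/
structure IsSymmetricFunction (F : MvPowerSeries ℕ ℤ) : Prop where
  symm : ∀ (e : Equiv.Perm ℕ) (m : ℕ →₀ ℕ),
    MvPowerSeries.coeff (m.mapDomain e) F = MvPowerSeries.coeff m F
  bounded : ∃ d : ℕ, ∀ m : ℕ →₀ ℕ, MvPowerSeries.coeff m F ≠ 0 → m.degree ≤ d

/-- All monomials occurring in `F` have total degree at most `k`. -/
def HasDegreeLE (F : MvPowerSeries ℕ ℤ) (k : ℕ) : Prop :=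
  ∀ m : ℕ →₀ ℕ, MvPowerSeries.coeff m F ≠ 0 → m.degree ≤ k

/-- The group algebra `ℤ[Sₙ]`, where `Sₙ` acts on `{0, …, n - 1}`. -/
abbrev SymGroupAlgebra (n : ℕ) : Type := MonoidAlgebra ℤ (Equiv.Perm (Fin n))

/-- The Jucys–Murphy element: the sum of the transpositions `(j i)` over all `j < i`. -/
noncomputable def jucysMurphy (n : ℕ) (i : Fin n) : SymGroupAlgebra n :=
  ∑ j ∈ Finset.Iio i, MonoidAlgebra.of ℤ (Equiv.Perm (Fin n)) (Equiv.swap j i)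

/-- The value at the Jucys–Murphy elements of the monomial with exponents `m`. These elements
commute; the factors are written in increasing order of the index. -/
noncomputable def jucysMurphyMonomial (n : ℕ) (m : Fin n →₀ ℕ) : SymGroupAlgebra n :=
  (List.ofFn fun i : Fin n => jucysMurphy n i ^ m i).prod

/-- The evaluation of `F` with its first `n` variables replaced by the Jucys–Murphy elements of
`ℤ[Sₙ]` and all the other variables replaced by `0`. If `F` has bounded degree then only finitely
many terms of the sum are nonzero. -/
noncomputable def evalJucysMurphy (F : MvPowerSeries ℕ ℤ) (n : ℕ) : SymGroupAlgebra n :=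
  ∑ᶠ m : Fin n →₀ ℕ,
    MvPowerSeries.coeff (m.mapDomain (Fin.val : Fin n → ℕ)) F • jucysMurphyMonomial n m

/-- The sum in `ℤ[Sₙ]` of all permutations of cycle type `lam` (fixed points are counted as parts
equal to `1`). -/
noncomputable def classSum {n : ℕ} (lam : n.Partition) : SymGroupAlgebra n :=
  ∑ σ : Equiv.Perm (Fin n) with σ.partition.parts = lam.parts,
    MonoidAlgebra.of ℤ (Equiv.Perm (Fin n)) σ

/-- The integers `a n lam` (for `lam` a partition of `n`) are, for every `n`, the coefficients of
the class expansion of `F` evaluated at the Jucys–Murphy elements of `ℤ[Sₙ]`. -/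
def IsClassExpansion (F : MvPowerSeries ℕ ℤ) (a : (n : ℕ) → n.Partition → ℤ) : Prop :=
  ∀ n : ℕ, evalJucysMurphy F n = ∑ lam : n.Partition, a n lam • classSum lam

/-- The partition `ρ ∪ 1ᵗ`, obtained from `ρ` by adding `t` parts equal to `1`. -/
def addOnes {r : ℕ} (ρ : r.Partition) (t : ℕ) : (r + t).Partition where
  parts := ρ.parts + Multiset.replicate t 1
  parts_pos := by
    intro i hi
    rcases Multiset.mem_add.1 hi with h | h
    · exact ρ.parts_pos h
    · rw [Multiset.eq_of_mem_replicate h]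
      exact Nat.one_pos
  parts_sum := by simp [ρ.parts_sum]

/-! A partial permutation is a pair (u, σ) with the support of σ inside u; products multiply the
permutations and unite the sets. Let its degree be |u| minus the number of nontrivial cycles of σ.
Multiplying by a transposition (a b) carried by {a, b} raises the degree by at most one
(`card_union_le_mul_swap`). Hence, if each transposition in the Jucys–Murphy elements is lifted in
this way, F of the lifts is spanned by partial permutations of degree at most k.

Keeping only those with u inside e gives back F at the Jucys–Murphy elements of the symmetric group
of e (`evalAt_liftedJucysMurphy_apply`). By centrality the coefficient of σ there depends only on
its cycle type q and on |e|. Inclusion–exclusion over e isolates the pairs whose u is the whole set,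
and none exist once that set has more than k + ℓ(q) elements. Grouped by |e|, the alternating sum is
an iterated forward difference of the coefficient at |q|, so all differences of high order vanish
and Newton's formula gives the polynomial.

Centrality, hence existence of the expansion, follows from s J_{i+1} = J_i s + 1 for s = (i i+1):
every symmetric polynomial in J_i, J_{i+1} commutes with s. -/

open Equiv.Perm in
theorem Equiv.Perm.card_cycleType {α : Type*} [Fintype α] [DecidableEq α] (σ : Equiv.Perm α) :
    Multiset.card σ.cycleType = σ.cycleFactorsFinset.card := by
  rw [cycleType_def, Multiset.card_map]; rfl

/-! ### Nontrivial cycles after multiplication by a transposition. -/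

namespace Equiv.Perm

variable {α : Type*} [Fintype α] [DecidableEq α]

/-- The nontrivial cycles of `σ` through `a` or `b`. -/
def cyclesThrough (σ : Perm α) (a b : α) : Finset (Perm α) :=
  σ.cycleFactorsFinset.filter fun c => a ∈ c.support ∨ b ∈ c.support

theorem cyclesThrough_subset (σ : Perm α) (a b : α) :
    σ.cyclesThrough a b ⊆ {σ.cycleOf a, σ.cycleOf b} := by
  intro c hc
  obtain ⟨hc, h⟩ := Finset.mem_filter.1 hc
  rw [Finset.mem_insert, Finset.mem_singleton]
  exact h.imp (fun h => cycle_is_cycleOf h hc) (fun h => cycle_is_cycleOf h hc)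

theorem card_cyclesThrough_pos {σ : Perm α} {a b : α} (h : σ a ≠ a ∨ σ b ≠ b) :
    0 < (σ.cyclesThrough a b).card := by
  rw [Finset.card_pos]
  rcases h with h | h
  · exact ⟨σ.cycleOf a, Finset.mem_filter.2
      ⟨cycleOf_mem_cycleFactorsFinset_iff.2 (mem_support.2 h), Or.inl <| by simpa using h⟩⟩
  · exact ⟨σ.cycleOf b, Finset.mem_filter.2
      ⟨cycleOf_mem_cycleFactorsFinset_iff.2 (mem_support.2 h), Or.inr <| by simpa using h⟩⟩

/-- Cycles of σ avoiding both a and b survive unchanged in `σ * swap a b`, so only those through a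
or b can be lost. -/
theorem card_cycleType_add_le (σ : Perm α) (a b : α) :
    Multiset.card σ.cycleType + ((σ * swap a b).cyclesThrough a b).card ≤
      Multiset.card (σ * swap a b).cycleType + (σ.cyclesThrough a b).card := by
  have key : ∀ τ : Perm α, (τ.cyclesThrough a b).card +
      (τ.cycleFactorsFinset.filter fun c => ¬(a ∈ c.support ∨ b ∈ c.support)).card =
        Multiset.card τ.cycleType := fun τ => by
    rw [card_cycleType, cyclesThrough, Finset.card_filter_add_card_filter_not]
  have hsub : (σ.cycleFactorsFinset.filter fun c => ¬(a ∈ c.support ∨ b ∈ c.support)) ⊆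
      (σ * swap a b).cycleFactorsFinset.filter
        fun c => ¬(a ∈ c.support ∨ b ∈ c.support) := by
    intro c hc
    obtain ⟨hc, h⟩ := Finset.mem_filter.1 hc
    refine Finset.mem_filter.2 ⟨?_, h⟩
    rw [mem_cycleFactorsFinset_iff] at hc ⊢
    refine ⟨hc.1, fun x hx => ?_⟩
    rw [hc.2 x hx, mul_apply, swap_apply_of_ne_of_ne]
    · rintro rfl; exact h (Or.inl hx)
    · rintro rfl; exact h (Or.inr hx)
  have := Finset.card_le_card hsub
  have h1 := key σ
  have h2 := key (σ * swap a b)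
  omega

theorem card_cycleType_le_mul_swap (σ : Perm α) (a b : α) :
    Multiset.card σ.cycleType ≤ Multiset.card (σ * swap a b).cycleType + 1 := by
  have h := σ.card_cycleType_add_le a b
  by_cases h1 : (σ.cyclesThrough a b).card ≤ 1
  · omega
  have h2 : (σ.cyclesThrough a b).card ≤ 2 :=
    (Finset.card_le_card (σ.cyclesThrough_subset a b)).trans Finset.card_le_two
  -- If the product fixed a, then σ b = a, and only one cycle of σ could meet {a, b}.
  have h3 : 0 < ((σ * swap a b).cyclesThrough a b).card := by
    refine card_cyclesThrough_pos (Or.inl fun h => h1 ?_)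
    rw [mul_apply, swap_apply_left] at h
    have hs : SameCycle σ b a := ⟨1, by simpa using h⟩
    refine (Finset.card_le_card (σ.cyclesThrough_subset a b)).trans ?_
    rw [hs.cycleOf_eq]
    simp
  omega

theorem card_cycleType_le_mul_swap_of_apply_eq {σ : Perm α} {a b : α} (hab : a ≠ b)
    (ha : σ a = a) : Multiset.card σ.cycleType ≤ Multiset.card (σ * swap a b).cycleType := by
  have h := σ.card_cycleType_add_le a b
  have h2 : (σ.cyclesThrough a b).card ≤ 1 := by
    refine (Finset.card_le_card (t := {σ.cycleOf b}) fun c hc => ?_).trans (by simp)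
    obtain ⟨hc, h⟩ := Finset.mem_filter.1 hc
    rw [Finset.mem_singleton]
    refine cycle_is_cycleOf (h.resolve_left fun h => ?_) hc
    exact mem_support.1 (mem_cycleFactorsFinset_support_le hc h) ha
  have h3 : 0 < ((σ * swap a b).cyclesThrough a b).card := by
    refine card_cyclesThrough_pos (Or.inr ?_)
    rwa [mul_apply, swap_apply_right, ha]
  omega

theorem card_cycleType_lt_mul_swap {σ : Perm α} {a b : α} (hab : a ≠ b)
    (ha : σ a = a) (hb : σ b = b) :
    Multiset.card σ.cycleType < Multiset.card (σ * swap a b).cycleType := by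
  have h := σ.card_cycleType_add_le a b
  have h2 : (σ.cyclesThrough a b).card = 0 := by
    rw [Finset.card_eq_zero, cyclesThrough, Finset.filter_eq_empty_iff]
    rintro c hc (h | h)
    · exact mem_support.1 (mem_cycleFactorsFinset_support_le hc h) ha
    · exact mem_support.1 (mem_cycleFactorsFinset_support_le hc h) hb
  have h3 : 0 < ((σ * swap a b).cyclesThrough a b).card := by
    refine card_cyclesThrough_pos (Or.inr ?_)
    rwa [mul_apply, swap_apply_right, ha]
  omega

/-- Points of {a, b} outside u are fixed by σ. With 0, 1 or 2 such points, the number of cycles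
falls by at most 1, does not fall, or rises by at least 1, which in each case pays for all but one
unit of the growth. -/
theorem card_union_le_mul_swap {σ : Perm α} {u : Finset α} (hu : σ.support ⊆ u) {j : ℕ}
    (hj : u.card ≤ j + Multiset.card σ.cycleType) {a b : α} (hab : a ≠ b) :
    (u ∪ {a, b}).card ≤ j + 1 + Multiset.card (σ * swap a b).cycleType := by
  have hfix : ∀ x, x ∉ u → σ x = x := fun x hx => by
    by_contra h
    exact hx (hu (mem_support.2 h))
  have hun : u ∪ {a, b} = insert a (insert b u) := by
    ext x; simp only [Finset.mem_union, Finset.mem_insert, Finset.mem_singleton]; tauto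
  rw [hun]
  by_cases ha : a ∈ u <;> by_cases hb : b ∈ u
  · rw [Finset.insert_eq_of_mem hb, Finset.insert_eq_of_mem ha]
    have := σ.card_cycleType_le_mul_swap a b
    omega
  · rw [Finset.insert_eq_of_mem (Finset.mem_insert_of_mem ha), Finset.card_insert_of_notMem hb]
    have := card_cycleType_le_mul_swap_of_apply_eq hab.symm (hfix b hb)
    rw [swap_comm] at this
    omega
  · rw [Finset.insert_eq_of_mem hb, Finset.card_insert_of_notMem ha]
    have := card_cycleType_le_mul_swap_of_apply_eq hab (hfix a ha)
    omega
  · have := card_cycleType_lt_mul_swap hab (hfix a ha) (hfix b hb)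
    have h1 := Finset.card_insert_le a (insert b u)
    have h2 := Finset.card_insert_le b u
    omega

end Equiv.Perm

/-! ### Partial permutations and their degree filtration. -/

section PartialPermutations

open Equiv

variable {α : Type*} [DecidableEq α]

/-- The partial permutation `σ` of `u`, seen as the function that maps a set `e` to `σ` if `e`
contains `u`, and to `0` otherwise. -/
noncomputable def partialPerm (u : Finset α) (σ : Perm α) (e : Finset α) :
    MonoidAlgebra ℤ (Perm α) :=
  if u ⊆ e then MonoidAlgebra.of ℤ (Perm α) σ else 0

theorem partialPerm_mul (u v : Finset α) (σ τ : Perm α) :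
    partialPerm u σ * partialPerm v τ = partialPerm (u ∪ v) (σ * τ) := by
  funext e
  simp only [Pi.mul_apply, partialPerm, Finset.union_subset_iff, map_mul]
  split_ifs <;> simp_all

theorem partialPerm_empty_one : partialPerm (∅ : Finset α) 1 = 1 := by
  funext e
  simp [partialPerm, MonoidAlgebra.one_def]

variable [Fintype α]

variable (α) in
/-- The span of the partial permutations `σ` of `u` for which the size of `u` exceeds the number of
nontrivial cycles of `σ` by at most `j`. -/
noncomputable def partialPermFiltration (j : ℕ) :
    Submodule ℤ (Finset α → MonoidAlgebra ℤ (Perm α)) :=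
  Submodule.span ℤ {f | ∃ (u : Finset α) (σ : Perm α), σ.support ⊆ u ∧
    u.card ≤ j + Multiset.card σ.cycleType ∧ f = partialPerm u σ}

theorem partialPermFiltration_mono : Monotone (partialPermFiltration α) := by
  intro i j hij
  refine Submodule.span_mono ?_
  rintro f ⟨u, σ, h1, h2, rfl⟩
  exact ⟨u, σ, h1, by omega, rfl⟩

theorem one_mem_partialPermFiltration : 1 ∈ partialPermFiltration α 0 :=
  Submodule.subset_span ⟨∅, 1, by simp, by simp, partialPerm_empty_one.symm⟩

theorem mul_partialPerm_swap_mem {j : ℕ} {f : Finset α → MonoidAlgebra ℤ (Perm α)}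
    (hf : f ∈ partialPermFiltration α j) {a b : α} (hab : a ≠ b) :
    f * partialPerm {a, b} (swap a b) ∈ partialPermFiltration α (j + 1) := by
  induction hf using Submodule.span_induction with
  | mem f hf =>
    obtain ⟨u, σ, h1, h2, rfl⟩ := hf
    refine Submodule.subset_span ⟨u ∪ {a, b}, σ * swap a b, ?_,
      Perm.card_union_le_mul_swap h1 h2 hab, partialPerm_mul ..⟩
    refine (Perm.support_mul_le σ (swap a b)).trans (sup_le_sup h1 ?_)
    rw [Perm.support_swap hab]
  | zero => rw [zero_mul]; exact zero_mem _
  | add f g _ _ hf hg => rw [add_mul]; exact add_mem hf hg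
  | smul c f _ hf => rw [smul_mul_assoc]; exact Submodule.smul_mem _ c hf

theorem coeff_eq_zero_of_not_subset {j : ℕ} {f : Finset α → MonoidAlgebra ℤ (Perm α)}
    (hf : f ∈ partialPermFiltration α j) {e : Finset α} {σ : Perm α} (h : ¬σ.support ⊆ e) :
    (f e).coeff σ = 0 := by
  induction hf using Submodule.span_induction with
  | mem f hf =>
    obtain ⟨u, τ, h1, -, rfl⟩ := hf
    rw [partialPerm]
    split_ifs with hu
    · have : τ ≠ σ := by rintro rfl; exact h (h1.trans hu)
      simp [this]
    · simp
  | zero => simp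
  | add f g _ _ hf hg => simp [hf, hg]
  | smul c f _ hf => rw [Pi.smul_apply, MonoidAlgebra.coeff_smul_apply, hf, smul_zero]

/-- Toggling a point outside u is a sign-reversing involution on the sets containing u. -/
theorem sum_neg_one_pow_card_of_subset {u : Finset α} (hu : u ≠ Finset.univ) :
    ∑ e : Finset α, (if u ⊆ e then (-1 : ℤ) ^ e.card else 0) = 0 := by
  obtain ⟨x, hx⟩ : ∃ x, x ∉ u := by
    by_contra! h
    exact hu (Finset.eq_univ_iff_forall.2 h)
  rw [← Finset.sum_filter]
  have key : ∀ e : Finset α, u ⊆ e → x ∈ e → u ⊆ e.erase x := fun e he _ y hy =>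
    Finset.mem_erase.2 ⟨by rintro rfl; exact hx hy, he hy⟩
  refine Finset.sum_involution (fun e _ => if x ∈ e then e.erase x else insert x e) ?_ ?_ ?_ ?_
  · intro e _
    split_ifs with h
    · rw [← Finset.card_erase_add_one h, pow_succ]; ring
    · rw [Finset.card_insert_of_notMem h, pow_succ]; ring
  · intro e _ _ h
    split_ifs at h with hxe
    · rw [← h] at hxe; simp at hxe
    · exact hxe (by rw [← h]; simp)
  · intro e he
    rw [Finset.mem_filter] at he
    split_ifs with h
    · simpa using key e he.2 h
    · simpa using he.2.trans (Finset.subset_insert _ _)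
  · intro e _
    split_ifs with h h' h'
    · simp at h'
    · exact Finset.insert_erase h
    · exact Finset.erase_insert h
    · simp at h'

/-- Up to sign, the sum extracts the part carried by the full set; the bound on `σ` excludes such
generators from the filtration. -/
theorem sum_neg_one_pow_card_mul_coeff_eq_zero {k : ℕ}
    {f : Finset α → MonoidAlgebra ℤ (Perm α)} (hf : f ∈ partialPermFiltration α k) {σ : Perm α}
    (hσ : k + Multiset.card σ.cycleType < Fintype.card α) :
    ∑ e : Finset α, (-1 : ℤ) ^ e.card * (f e).coeff σ = 0 := by
  induction hf using Submodule.span_induction with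
  | mem f hf =>
    obtain ⟨u, τ, h1, h2, rfl⟩ := hf
    by_cases hτ : τ = σ
    · subst hτ
      rw [← sum_neg_one_pow_card_of_subset (u := u)]
      · refine Finset.sum_congr rfl fun e _ => ?_
        rw [partialPerm]
        split_ifs <;> simp
      · rintro rfl
        rw [Finset.card_univ] at h2
        omega
    · refine Finset.sum_eq_zero fun e _ => ?_
      rw [partialPerm]
      split_ifs <;> simp [hτ]
  | zero => simp
  | add f g _ _ hf hg => simp [mul_add, Finset.sum_add_distrib, hf, hg]
  | smul c f _ hf =>
    simp only [Pi.smul_apply, MonoidAlgebra.coeff_smul_apply, smul_eq_mul, mul_left_comm _ c,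
      ← Finset.mul_sum, hf, mul_zero]

end PartialPermutations

/-! ### Evaluation of symmetric functions in noncommutative rings. -/

section EvalAt

variable {R S : Type*} [Ring R] [Ring S]

/-- The value of `F` at `x₀, …, xₙ₋₁, 0, 0, …`, where the factors of each monomial are written in
increasing order of the index. -/
noncomputable def evalAt (F : MvPowerSeries ℕ ℤ) {n : ℕ} (x : Fin n → R) : R :=
  ∑ᶠ m : Fin n →₀ ℕ, MvPowerSeries.coeff (m.mapDomain (Fin.val : Fin n → ℕ)) F •
    (List.ofFn fun i : Fin n => x i ^ m i).prod

theorem evalJucysMurphy_eq_evalAt (F : MvPowerSeries ℕ ℤ) (n : ℕ) :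
    evalJucysMurphy F n = evalAt F (jucysMurphy n) :=
  rfl

theorem HasDegreeLE.degree_le {F : MvPowerSeries ℕ ℤ} {k : ℕ} (hk : HasDegreeLE F k) {n : ℕ}
    {m : Fin n →₀ ℕ} (h : MvPowerSeries.coeff (m.mapDomain (Fin.val : Fin n → ℕ)) F ≠ 0) :
    m.degree ≤ k := by
  have := hk _ h
  rwa [Finsupp.degree_mapDomain] at this

theorem HasDegreeLE.finite_support {F : MvPowerSeries ℕ ℤ} {k : ℕ} (hk : HasDegreeLE F k) {n : ℕ}
    (f : (Fin n →₀ ℕ) → R) :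
    (Function.support fun m : Fin n →₀ ℕ =>
      MvPowerSeries.coeff (m.mapDomain (Fin.val : Fin n → ℕ)) F • f m).Finite := by
  refine (Finsupp.finite_of_degree_le (σ := Fin n) k).subset fun m hm => hk.degree_le fun h => hm ?_
  simp only [h, zero_smul]

theorem map_evalAt {F : MvPowerSeries ℕ ℤ} {k : ℕ} (hk : HasDegreeLE F k) {n : ℕ}
    (x : Fin n → R) (φ : R →+* S) : φ (evalAt F x) = evalAt F fun i => φ (x i) := by
  refine (φ.toAddMonoidHom.map_finsum (hk.finite_support _)).trans (finsum_congr fun m => ?_)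
  change φ _ = _
  rw [map_zsmul, map_list_prod, List.map_ofFn]
  congr 3
  funext i
  simp

theorem List.prod_map_filter {ι M : Type*} [Monoid M] (l : List ι) (p : ι → Bool) (f : ι → M)
    (h : ∀ i ∈ l, p i = false → f i = 1) : ((l.filter p).map f).prod = (l.map f).prod := by
  induction l with
  | nil => rfl
  | cons a l ih =>
    have ih := ih fun i hi => h i (List.mem_cons_of_mem _ hi)
    cases hp : p a
    · simp [hp, ih, h a List.mem_cons_self hp]
    · simp [hp, ih]

theorem List.map_finRange_orderEmbedding {m n : ℕ} (ι : Fin m ↪o Fin n) (p : Fin n → Bool)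
    (hp : ∀ i, p i = true ↔ i ∈ Set.range ι) :
    (List.finRange n).filter p = (List.finRange m).map ι := by
  refine List.Perm.eq_of_pairwise' (r := (· < ·)) ?_ ?_ ?_
  · exact (List.pairwise_lt_finRange n).filter _
  · exact (List.pairwise_lt_finRange m).map _ fun a b h => ι.strictMono h
  · refine (List.perm_ext_iff_of_nodup ((List.nodup_finRange n).filter _)
      ((List.nodup_finRange m).map ι.injective)).2 fun i => ?_
    simp [hp]

theorem IsSymmetricFunction.coeff_mapDomain {F : MvPowerSeries ℕ ℤ} (hF : IsSymmetricFunction F)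
    {n : ℕ} (f g : Fin n ↪ ℕ) (m : Fin n →₀ ℕ) :
    MvPowerSeries.coeff (m.mapDomain f) F = MvPowerSeries.coeff (m.mapDomain g) F := by
  obtain ⟨e, he⟩ := Equiv.Perm.exists_smul_eq_embedding f g
  rw [← hF.symm e, ← Finsupp.mapDomain_comp, ← he]
  rfl

/-- The values need not commute, so the embedding has to preserve the order of the factors; symmetry
of `F` matches the coefficients of the surviving monomials. -/
theorem evalAt_eq_comp_orderEmbedding {F : MvPowerSeries ℕ ℤ} (hF : IsSymmetricFunction F)
    {m n : ℕ} (ι : Fin m ↪o Fin n) (x : Fin n → R) (hx : ∀ i, i ∉ Set.range ι → x i = 0) :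
    evalAt F x = evalAt F (x ∘ ι) := by
  classical
  have hinj : Function.Injective (Finsupp.mapDomain (M := ℕ) ι) :=
    Finsupp.mapDomain_injective ι.injective
  have hterm : ∀ a : Fin n →₀ ℕ, a ∉ Set.range (Finsupp.mapDomain (M := ℕ) ι) →
      (List.ofFn fun i : Fin n => x i ^ a i).prod = 0 := by
    intro a ha
    obtain ⟨i, hi, hai⟩ : ∃ i, i ∉ Set.range ι ∧ a i ≠ 0 := by
      by_contra! h
      refine ha ⟨a.comapDomain ι ι.injective.injOn,
        Finsupp.mapDomain_comapDomain ι ι.injective _ ?_⟩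
      intro i hi
      by_contra hi'
      exact Finsupp.mem_support_iff.1 hi (h i hi')
    refine List.prod_eq_zero (List.mem_ofFn.2 ⟨i, ?_⟩)
    rw [hx i hi, zero_pow hai]
  unfold evalAt
  rw [← finsum_mem_univ,
    finsum_mem_inter_support_eq' _ _ (Set.range (Finsupp.mapDomain (M := ℕ) ι)),
    finsum_mem_range hinj]
  · refine finsum_congr fun a => ?_
    congr 1
    · have := hF.coeff_mapDomain (ι.toEmbedding.trans Fin.valEmbedding) Fin.valEmbedding a
      rw [← Finsupp.mapDomain_comp]
      exact this
    · rw [List.ofFn_eq_map, List.ofFn_eq_map,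
        ← List.prod_map_filter _ (fun i => decide (i ∈ Set.range ι)),
        List.map_finRange_orderEmbedding ι _ (by simp), List.map_map]
      · refine congrArg _ (List.map_congr_left fun i _ => ?_)
        simp [Finsupp.mapDomain_apply ι.injective]
      · intro i _ hi
        rw [Finsupp.mapDomain_of_notMem_range _ _ (by simpa using hi), pow_zero]
  · refine fun a ha => iff_of_true trivial ?_
    by_contra h
    exact ha (by simp only [hterm a h, smul_zero])

end EvalAt

/-! ### Lifted Jucys–Murphy elements and their restriction to subsets. -/

section Lift

open Equiv

/-- The Jucys–Murphy element as a function of the set in which the transpositions lie. -/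
noncomputable def liftedJucysMurphy (n : ℕ) (i : Fin n) : Finset (Fin n) → SymGroupAlgebra n :=
  ∑ j ∈ Finset.Iio i, partialPerm {j, i} (swap j i)

theorem mul_liftedJucysMurphy_pow_mem {n j : ℕ} {f : Finset (Fin n) → SymGroupAlgebra n}
    (hf : f ∈ partialPermFiltration (Fin n) j) (i : Fin n) (p : ℕ) :
    f * liftedJucysMurphy n i ^ p ∈ partialPermFiltration (Fin n) (j + p) := by
  induction p with
  | zero => simpa using hf
  | succ p ih =>
    rw [pow_succ, ← mul_assoc, ← add_assoc]
    nth_rewrite 2 [liftedJucysMurphy]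
    rw [Finset.mul_sum]
    exact Submodule.sum_mem _ fun l hl => mul_partialPerm_swap_mem ih (Finset.mem_Iio.1 hl).ne

theorem mul_list_prod_liftedJucysMurphy_mem {n : ℕ} (m : Fin n →₀ ℕ) (l : List (Fin n)) {j : ℕ}
    {f : Finset (Fin n) → SymGroupAlgebra n} (hf : f ∈ partialPermFiltration (Fin n) j) :
    f * (l.map fun i => liftedJucysMurphy n i ^ m i).prod ∈
      partialPermFiltration (Fin n) (j + (l.map m).sum) := by
  induction l generalizing j f with
  | nil => simpa using hf
  | cons a l ih =>
    simp only [List.map_cons, List.prod_cons, List.sum_cons]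
    rw [← mul_assoc, ← add_assoc]
    exact ih (mul_liftedJucysMurphy_pow_mem hf a (m a))

theorem evalAt_liftedJucysMurphy_mem {F : MvPowerSeries ℕ ℤ} {k : ℕ} (hk : HasDegreeLE F k)
    (n : ℕ) : evalAt F (liftedJucysMurphy n) ∈ partialPermFiltration (Fin n) k := by
  refine finsum_induction (· ∈ partialPermFiltration (Fin n) k) (zero_mem _)
    (fun _ _ => add_mem) fun m => ?_
  by_cases h : MvPowerSeries.coeff (m.mapDomain (Fin.val : Fin n → ℕ)) F = 0
  · rw [h, zero_smul]; exact zero_mem _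
  refine Submodule.smul_mem _ _ (partialPermFiltration_mono (hk.degree_le h) ?_)
  have := mul_list_prod_liftedJucysMurphy_mem m (List.finRange n) one_mem_partialPermFiltration
  rwa [one_mul, zero_add, ← List.ofFn_eq_map, ← List.ofFn_eq_map, List.sum_ofFn,
    ← Finsupp.degree_eq_sum] at this

theorem liftedJucysMurphy_apply (n : ℕ) (i : Fin n) (e : Finset (Fin n)) :
    liftedJucysMurphy n i e = ∑ j ∈ Finset.Iio i,
      if {j, i} ⊆ e then MonoidAlgebra.of ℤ (Perm (Fin n)) (swap j i) else 0 := by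
  rw [liftedJucysMurphy, Finset.sum_apply]
  rfl

theorem Equiv.Perm.viaEmbedding_swap {α β : Type*} [DecidableEq α] [DecidableEq β] (ι : α ↪ β)
    (a b : α) : (swap a b).viaEmbedding ι = swap (ι a) (ι b) := by
  ext x
  by_cases hx : x ∈ Set.range ι
  · obtain ⟨y, rfl⟩ := hx
    rw [Perm.viaEmbedding_apply, ι.injective.map_swap]
  · rw [Perm.viaEmbedding_apply_of_notMem _ _ _ hx, swap_apply_of_ne_of_ne]
    · rintro rfl; exact hx ⟨a, rfl⟩
    · rintro rfl; exact hx ⟨b, rfl⟩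

/-- The inclusion of symmetric group algebras induced by an embedding. -/
noncomputable def SymGroupAlgebra.embed {m n : ℕ} (ι : Fin m ↪o Fin n) :
    SymGroupAlgebra m →+* SymGroupAlgebra n :=
  MonoidAlgebra.mapDomainRingHom ℤ (Perm.viaEmbeddingHom ι.toEmbedding)

/-- At e only the transpositions inside e survive; as `ι` is increasing, they are the images of
those with j < i. -/
theorem embed_jucysMurphy {n : ℕ} (e : Finset (Fin n)) {m : ℕ} (ι : Fin m ↪o Fin n)
    (hι : Set.range ι = e) (i : Fin m) :
    SymGroupAlgebra.embed ι (jucysMurphy m i) = liftedJucysMurphy n (ι i) e := by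
  have hmem : ∀ x, x ∈ e ↔ ∃ y, ι y = x := fun x => by rw [← Finset.mem_coe, ← hι]; rfl
  have hi : ι i ∈ e := (hmem _).2 ⟨i, rfl⟩
  rw [liftedJucysMurphy_apply, ← Finset.sum_filter, jucysMurphy, map_sum]
  have himg : (Finset.Iio (ι i)).filter (fun j => {j, ι i} ⊆ e) =
      (Finset.Iio i).map ι.toEmbedding := by
    ext x
    simp only [Finset.mem_filter, Finset.mem_Iio, Finset.insert_subset_iff,
      Finset.singleton_subset_iff, hi, and_true, Finset.mem_map, hmem]
    constructor
    · rintro ⟨h, y, rfl⟩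
      exact ⟨y, ι.lt_iff_lt.1 h, rfl⟩
    · rintro ⟨y, h, rfl⟩
      exact ⟨ι.lt_iff_lt.2 h, y, rfl⟩
  rw [himg, Finset.sum_map]
  refine Finset.sum_congr rfl fun j _ => ?_
  rw [SymGroupAlgebra.embed, MonoidAlgebra.of_apply, MonoidAlgebra.mapDomainRingHom_apply,
    MonoidAlgebra.mapDomain_single, Perm.viaEmbeddingHom_apply, Perm.viaEmbedding_swap]
  rfl

theorem liftedJucysMurphy_apply_of_notMem {n : ℕ} {e : Finset (Fin n)} {i : Fin n} (hi : i ∉ e) :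
    liftedJucysMurphy n i e = 0 := by
  rw [liftedJucysMurphy_apply]
  refine Finset.sum_eq_zero fun j _ => if_neg fun h => hi (h (by simp))

/-- Evaluation at e is a ring homomorphism that kills the variables indexed outside e, and symmetry
allows these to be dropped. -/
theorem evalAt_liftedJucysMurphy_apply {F : MvPowerSeries ℕ ℤ} (hF : IsSymmetricFunction F)
    {k : ℕ} (hk : HasDegreeLE F k) {n : ℕ} (e : Finset (Fin n)) {m : ℕ} (ι : Fin m ↪o Fin n)
    (hι : Set.range ι = e) :
    evalAt F (liftedJucysMurphy n) e = SymGroupAlgebra.embed ι (evalJucysMurphy F m) := by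
  rw [evalJucysMurphy_eq_evalAt, map_evalAt hk]
  refine (map_evalAt hk _ (Pi.evalRingHom (fun _ => SymGroupAlgebra n) e)).trans ?_
  rw [evalAt_eq_comp_orderEmbedding hF ι]
  · congr 1
    funext i
    exact (embed_jucysMurphy e ι hι i).symm
  · intro i hi
    exact liftedJucysMurphy_apply_of_notMem fun h => hi (by rw [hι]; exact h)

theorem coeff_embed {m n : ℕ} (ι : Fin m ↪o Fin n) (x : SymGroupAlgebra m) (σ : Perm (Fin m)) :
    (SymGroupAlgebra.embed ι x).coeff (σ.viaEmbedding ι.toEmbedding) = x.coeff σ :=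
  Finsupp.mapDomain_apply (Perm.viaEmbeddingHom_injective ι.toEmbedding) _ _

theorem Equiv.Perm.cycleType_viaEmbedding {α β : Type*} [Fintype α] [DecidableEq α] [Fintype β]
    [DecidableEq β] (ι : α ↪ β) (σ : Perm α) :
    (σ.viaEmbedding ι).cycleType = σ.cycleType := by
  exact @cycleType_extendDomain α _ _ β _ _ (· ∈ Set.range ι)
    (fun _ => Classical.propDecidable _) (ofInjective ι ι.injective) σ

theorem Equiv.Perm.exists_viaEmbedding_eq {α β : Type*} [Fintype β] [DecidableEq β]
    (ι : α ↪ β) (σ : Perm β) (h : ∀ x, σ x ≠ x → x ∈ Set.range ι) :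
    ∃ τ : Perm α, τ.viaEmbedding ι = σ := by
  have hmap : ∀ x, σ x ∈ Set.range ι ↔ x ∈ Set.range ι := by
    intro x
    by_cases hx : σ x = x
    · rw [hx]
    · exact iff_of_true (h _ fun h' => hx (σ.injective h')) (h x hx)
  refine ⟨(Equiv.ofInjective ι ι.injective).symm.permCongr
    (σ.subtypePerm hmap), ?_⟩
  ext x
  by_cases hx : x ∈ Set.range ι
  · obtain ⟨y, rfl⟩ := hx
    rw [viaEmbedding_apply]
    simp [Equiv.apply_ofInjective_symm]
  · rw [viaEmbedding_apply_of_notMem _ _ _ hx]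
    by_contra h'
    exact hx (h x fun h => h' h.symm)

end Lift

/-! ### Centrality of symmetric functions of the Jucys–Murphy elements. -/

section Central

open Equiv

theorem commute_pow_add_pow {A : Type*} [Ring A] {s x y : A} (hxy : Commute x y)
    (h1 : Commute s (x + y)) (h2 : Commute s (x * y)) (d : ℕ) : Commute s (x ^ d + y ^ d) := by
  induction d using Nat.twoStepInduction with
  | zero => simp
  | one => simpa using h1
  | more d ih ih' =>
    have : x ^ (d + 2) + y ^ (d + 2) =
        (x + y) * (x ^ (d + 1) + y ^ (d + 1)) - x * y * (x ^ d + y ^ d) := by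
      have e1 : y * x ^ (d + 1) = x * y * x ^ d := by
        rw [pow_succ', ← mul_assoc, hxy.eq]
      have e2 : x * y ^ (d + 1) = x * y * y ^ d := by
        rw [pow_succ', ← mul_assoc]
      rw [add_mul, mul_add, mul_add, mul_add, e1, e2, ← pow_succ', ← pow_succ']
      abel
    rw [this]
    exact (h1.mul_right ih').sub_right (h2.mul_right ih)

theorem commute_pow_mul_pow_add {A : Type*} [Ring A] {s x y : A} (hxy : Commute x y)
    (h1 : Commute s (x + y)) (h2 : Commute s (x * y)) (a b : ℕ) :
    Commute s (x ^ a * y ^ b + x ^ b * y ^ a) := by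
  wlog hab : a ≤ b generalizing a b
  · rw [add_comm]
    exact this b a (le_of_not_ge hab)
  obtain ⟨d, rfl⟩ := Nat.exists_eq_add_of_le hab
  have : x ^ a * y ^ (a + d) + x ^ (a + d) * y ^ a = (x * y) ^ a * (x ^ d + y ^ d) := by
    rw [hxy.mul_pow, pow_add, pow_add, mul_add, mul_assoc (x ^ a) (y ^ a) (x ^ d),
      ← (hxy.pow_pow d a).eq, mul_assoc, mul_assoc, add_comm]
  rw [this]
  exact (h2.pow_right a).mul_right (commute_pow_add_pow hxy h1 h2 d)

/-- Conjugation by `σ` permutes the transpositions in the sum. -/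
theorem of_commute_jucysMurphy {n : ℕ} {σ : Perm (Fin n)} {i : Fin n} (hi : σ i = i)
    (h : ∀ j, j < i ↔ σ j < i) :
    Commute (MonoidAlgebra.of ℤ (Perm (Fin n)) σ) (jucysMurphy n i) := by
  rw [Commute, SemiconjBy, jucysMurphy, Finset.mul_sum, Finset.sum_mul]
  refine Finset.sum_equiv σ (fun j => ?_) fun j _ => ?_
  · rw [Finset.mem_Iio, Finset.mem_Iio, h]
  · rw [← map_mul, ← map_mul, mul_swap_eq_swap_mul, hi]

theorem commute_jucysMurphy {n : ℕ} {i j : Fin n} (hij : i < j) :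
    Commute (jucysMurphy n i) (jucysMurphy n j) := by
  rw [jucysMurphy]
  refine Commute.sum_left _ _ _ fun l hl => of_commute_jucysMurphy ?_ fun a => ?_
  · have hl := Finset.mem_Iio.1 hl
    exact swap_apply_of_ne_of_ne (hl.trans hij).ne' hij.ne'
  · have hl := (Finset.mem_Iio.1 hl).trans hij
    rw [swap_apply_def]
    split_ifs with h1 h2
    · simp [h1, hl, hij]
    · simp [h2, hl, hij]
    · rfl

theorem swap_castSucc_succ_lt_iff {n : ℕ} (i : Fin n) {j : Fin (n + 1)} (h2 : j ≠ i.succ)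
    (l : Fin (n + 1)) : l < j ↔ swap i.castSucc i.succ l < j := by
  rw [swap_apply_def]
  split_ifs with e1 e2
  · subst e1
    simp only [Fin.lt_def, Fin.ext_iff, Fin.val_castSucc, Fin.val_succ, ne_eq] at *
    omega
  · subst e2
    simp only [Fin.lt_def, Fin.ext_iff, Fin.val_castSucc, Fin.val_succ, ne_eq] at *
    omega
  · rfl

theorem swap_commute_jucysMurphy {n : ℕ} (i : Fin n) {j : Fin (n + 1)} (h1 : j ≠ i.castSucc)
    (h2 : j ≠ i.succ) :
    Commute (MonoidAlgebra.of ℤ (Perm (Fin (n + 1))) (swap i.castSucc i.succ))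
      (jucysMurphy (n + 1) j) :=
  of_commute_jucysMurphy (swap_apply_of_ne_of_ne h1 h2) (swap_castSucc_succ_lt_iff i h2)

theorem jucysMurphy_succ_mul_swap {n : ℕ} (i : Fin n) :
    jucysMurphy (n + 1) i.succ * MonoidAlgebra.of ℤ (Perm (Fin (n + 1))) (swap i.castSucc i.succ) =
      MonoidAlgebra.of ℤ (Perm (Fin (n + 1))) (swap i.castSucc i.succ) *
        jucysMurphy (n + 1) i.castSucc + 1 := by
  have hI : Finset.Iio i.succ = insert i.castSucc (Finset.Iio i.castSucc) := by
    ext x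
    simp only [Finset.mem_Iio, Finset.mem_insert, Fin.lt_def, Fin.ext_iff, Fin.val_castSucc,
      Fin.val_succ]
    omega
  rw [jucysMurphy, jucysMurphy, hI, Finset.sum_insert (by simp), add_mul, ← map_mul, swap_mul_self,
    map_one, add_comm (1 : SymGroupAlgebra (n + 1)), Finset.sum_mul, Finset.mul_sum]
  congr 1
  refine Finset.sum_congr rfl fun j hj => ?_
  have hj := Finset.mem_Iio.1 hj
  rw [← map_mul, ← map_mul, mul_swap_eq_swap_mul (swap i.castSucc i.succ), swap_apply_left,
    swap_apply_of_ne_of_ne hj.ne]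
  rintro rfl
  simp [Fin.lt_def] at hj

theorem swap_commute_pow_mul_pow_add {n : ℕ} (i : Fin n) (a b : ℕ) :
    Commute (MonoidAlgebra.of ℤ (Perm (Fin (n + 1))) (swap i.castSucc i.succ))
      (jucysMurphy (n + 1) i.castSucc ^ a * jucysMurphy (n + 1) i.succ ^ b +
        jucysMurphy (n + 1) i.castSucc ^ b * jucysMurphy (n + 1) i.succ ^ a) := by
  have hc := commute_jucysMurphy (Fin.castSucc_lt_succ (i := i))
  have e1 := jucysMurphy_succ_mul_swap i
  have hs : MonoidAlgebra.of ℤ (Perm (Fin (n + 1))) (swap i.castSucc i.succ) *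
      MonoidAlgebra.of ℤ (Perm (Fin (n + 1))) (swap i.castSucc i.succ) = 1 := by
    rw [← map_mul, swap_mul_self, map_one]
  generalize MonoidAlgebra.of ℤ (Perm (Fin (n + 1))) (swap i.castSucc i.succ) = s at *
  generalize jucysMurphy (n + 1) i.castSucc = x at *
  generalize jucysMurphy (n + 1) i.succ = y at *
  -- This is `e1` multiplied by s on both sides, with s² = 1.
  have e2 : s * y = x * s + 1 := by
    have : s * (y * s) * s = s * (s * x + 1) * s := by rw [e1]
    calc s * y = s * (y * s) * s := by rw [← mul_assoc, mul_assoc, hs, mul_one]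
      _ = s * s * x * s + s * s := by rw [this]; noncomm_ring
      _ = _ := by rw [hs, one_mul]
  have e3 : s * x = y * s - 1 := by rw [e1, add_sub_cancel_right]
  refine commute_pow_mul_pow_add hc ?_ ?_ a b
  · rw [Commute, SemiconjBy, mul_add, add_mul, e2, e3]
    abel
  · rw [Commute, SemiconjBy, ← mul_assoc, e3, sub_mul, mul_assoc, e2, mul_add, ← mul_assoc, one_mul,
      mul_one, add_sub_cancel_right, hc.eq]

theorem List.finRange_eq_append_castSucc_succ {n : ℕ} (i : Fin n) :
    ∃ l₁ l₂ : List (Fin (n + 1)), List.finRange (n + 1) = l₁ ++ i.castSucc :: i.succ :: l₂ ∧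
      (∀ j ∈ l₁, j ≠ i.castSucc ∧ j ≠ i.succ) ∧ ∀ j ∈ l₂, j ≠ i.castSucc ∧ j ≠ i.succ := by
  have h : List.finRange (n + 1) = (List.finRange (n + 1)).take i ++
      i.castSucc :: i.succ :: (List.finRange (n + 1)).drop (i + 2) := by
    conv_lhs => rw [← List.take_append_drop i (List.finRange (n + 1))]
    rw [List.drop_eq_getElem_cons (by simp), List.drop_eq_getElem_cons (by simp)]
    simp [Fin.ext_iff]
  have hn := List.nodup_finRange (n + 1)
  refine ⟨_, _, h, ?_⟩
  rw [h] at hn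
  simp only [List.nodup_append, List.nodup_cons, List.mem_cons, not_or] at hn
  obtain ⟨-, ⟨⟨-, h1⟩, h2, -⟩, h3⟩ := hn
  refine ⟨fun j hj => ⟨h3 j hj _ (Or.inl rfl), h3 j hj _ (Or.inr (Or.inl rfl))⟩, fun j hj => ⟨?_, ?_⟩⟩
  · rintro rfl; exact h1 hj
  · rintro rfl; exact h2 hj

theorem swap_commute_monomial_add {n : ℕ} (i : Fin n) {m m' : Fin (n + 1) →₀ ℕ}
    (h : ∀ j, m' j = m (swap i.castSucc i.succ j)) :
    Commute (MonoidAlgebra.of ℤ (Perm (Fin (n + 1))) (swap i.castSucc i.succ))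
      (jucysMurphyMonomial (n + 1) m + jucysMurphyMonomial (n + 1) m') := by
  obtain ⟨l₁, l₂, hl, h1, h2⟩ := List.finRange_eq_append_castSucc_succ i
  have hl' : ∀ l : List (Fin (n + 1)), (∀ j ∈ l, j ≠ i.castSucc ∧ j ≠ i.succ) →
      (l.map fun j => jucysMurphy (n + 1) j ^ m' j) =
        l.map fun j => jucysMurphy (n + 1) j ^ m j := fun l hl =>
    List.map_congr_left fun j hj => by rw [h, swap_apply_of_ne_of_ne (hl j hj).1 (hl j hj).2]
  have hcomm : ∀ l : List (Fin (n + 1)), (∀ j ∈ l, j ≠ i.castSucc ∧ j ≠ i.succ) →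
      Commute (MonoidAlgebra.of ℤ (Perm (Fin (n + 1))) (swap i.castSucc i.succ))
        (l.map fun j => jucysMurphy (n + 1) j ^ m j).prod := fun l hl => by
    refine Commute.list_prod_right _ _ fun x hx => ?_
    obtain ⟨j, hj, rfl⟩ := List.mem_map.1 hx
    exact (swap_commute_jucysMurphy i (hl j hj).1 (hl j hj).2).pow_right _
  rw [jucysMurphyMonomial, jucysMurphyMonomial, List.ofFn_eq_map, List.ofFn_eq_map, hl]
  simp only [List.map_append, List.map_cons, List.prod_append, List.prod_cons]
  rw [hl' l₁ h1, hl' l₂ h2, h, h, swap_apply_left, swap_apply_right, ← mul_add, ← mul_assoc,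
    ← mul_assoc, ← add_mul]
  exact (hcomm l₁ h1).mul_right ((swap_commute_pow_mul_pow_add i _ _).mul_right (hcomm l₂ h2))

theorem swap_commute_evalJucysMurphy {F : MvPowerSeries ℕ ℤ} (hF : IsSymmetricFunction F) {k : ℕ}
    (hk : HasDegreeLE F k) {n : ℕ} (i : Fin n) :
    Commute (MonoidAlgebra.of ℤ (Perm (Fin (n + 1))) (swap i.castSucc i.succ))
      (evalJucysMurphy F (n + 1)) := by
  set s := MonoidAlgebra.of ℤ (Perm (Fin (n + 1))) (swap i.castSucc i.succ)
  let ψ : (Fin (n + 1) →₀ ℕ) ≃ (Fin (n + 1) →₀ ℕ) :=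
    (Finsupp.domCongr (swap i.castSucc i.succ)).toEquiv
  have hcoeff : ∀ m : Fin (n + 1) →₀ ℕ,
      MvPowerSeries.coeff ((ψ m).mapDomain (Fin.val : Fin (n + 1) → ℕ)) F =
        MvPowerSeries.coeff (m.mapDomain (Fin.val : Fin (n + 1) → ℕ)) F := by
    intro m
    have hψ : ψ m = m.mapDomain (swap i.castSucc i.succ) :=
      Finsupp.equivMapDomain_eq_mapDomain _ _
    rw [hψ, ← Finsupp.mapDomain_comp]
    exact hF.coeff_mapDomain ((swap i.castSucc i.succ).toEmbedding.trans Fin.valEmbedding)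
      Fin.valEmbedding m
  have hsum : evalJucysMurphy F (n + 1) = ∑ᶠ m : Fin (n + 1) →₀ ℕ,
      MvPowerSeries.coeff (m.mapDomain (Fin.val : Fin (n + 1) → ℕ)) F •
        jucysMurphyMonomial (n + 1) (ψ m) := by
    rw [evalJucysMurphy, ← finsum_comp_equiv ψ]
    simp only [hcoeff]
  -- A single monomial need not commute with s, but its sum with the monomial of swapped exponents
  -- does; doubling the evaluation makes these pairs appear.
  have h2 : Commute s (evalJucysMurphy F (n + 1) + evalJucysMurphy F (n + 1)) := by
    nth_rewrite 2 [hsum]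
    rw [evalJucysMurphy, ← finsum_add_distrib (hk.finite_support _) (hk.finite_support _)]
    refine finsum_induction (Commute s ·) (Commute.zero_right _)
      (fun _ _ => Commute.add_right) fun m => ?_
    rw [← smul_add]
    exact (swap_commute_monomial_add i fun j => rfl).smul_right _
  have h3 : s * evalJucysMurphy F (n + 1) + s * evalJucysMurphy F (n + 1) =
      evalJucysMurphy F (n + 1) * s + evalJucysMurphy F (n + 1) * s := by
    rw [← mul_add, h2.eq, add_mul]
  -- The factor 2 is cancelled coefficientwise in ℤ.
  refine MonoidAlgebra.ext (Finsupp.ext fun σ => ?_)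
  have := congrArg (fun x => MonoidAlgebra.coeff x σ) h3
  simp only [MonoidAlgebra.coeff_add, Finsupp.add_apply] at this
  omega

theorem of_commute_evalJucysMurphy {F : MvPowerSeries ℕ ℤ} (hF : IsSymmetricFunction F) {k : ℕ}
    (hk : HasDegreeLE F k) {n : ℕ} (σ : Perm (Fin n)) :
    Commute (MonoidAlgebra.of ℤ (Perm (Fin n)) σ) (evalJucysMurphy F n) := by
  cases n with
  | zero => rw [Subsingleton.elim σ 1, map_one]; exact Commute.one_left _
  | succ n =>
    have hσ : σ ∈ Submonoid.closure
        (Set.range fun i : Fin n => swap i.castSucc i.succ) := by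
      rw [Perm.mclosure_swap_castSucc_succ]; trivial
    induction hσ using Submonoid.closure_induction with
    | mem x hx =>
      obtain ⟨i, rfl⟩ := hx
      exact swap_commute_evalJucysMurphy hF hk i
    | one => rw [map_one]; exact Commute.one_left _
    | mul x y _ _ hx hy => rw [map_mul]; exact hx.mul_left hy

theorem coeff_evalJucysMurphy_eq {F : MvPowerSeries ℕ ℤ} (hF : IsSymmetricFunction F) {k : ℕ}
    (hk : HasDegreeLE F k) {n : ℕ} {σ τ : Perm (Fin n)} (h : σ.cycleType = τ.cycleType) :
    (evalJucysMurphy F n).coeff σ = (evalJucysMurphy F n).coeff τ := by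
  obtain ⟨g, hg⟩ := isConj_iff.1 (Perm.isConj_of_cycleType_eq h)
  -- With τ = gσg⁻¹, so that gσ = τg, the two sides of the commutation have coefficients at gσ equal
  -- to those at σ and at τ.
  have := congrArg (fun x => MonoidAlgebra.coeff x (g * σ)) (of_commute_evalJucysMurphy hF hk g).eq
  simpa [MonoidAlgebra.of_apply, hg] using this

end Central

/-! ### Class coefficients, finite differences and polynomiality. -/

section Expansion

open Equiv

/-- The coefficient in `F(J₁, …, Jₙ)` of the permutations of cycle type `q`. -/
noncomputable def cycleTypeCoeff (F : MvPowerSeries ℕ ℤ) (q : Multiset ℕ) (n : ℕ) : ℤ :=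
  open Classical in
  -- When all parts of q are at least 2, the default 0 occurs only for n < `q.sum`; differences are
  -- taken from `q.sum` on and never see it.
  if h : ∃ σ : Perm (Fin n), σ.cycleType = q then (evalJucysMurphy F n).coeff h.choose else 0

theorem cycleTypeCoeff_cycleType {F : MvPowerSeries ℕ ℤ} (hF : IsSymmetricFunction F) {k : ℕ}
    (hk : HasDegreeLE F k) {n : ℕ} (σ : Perm (Fin n)) :
    cycleTypeCoeff F σ.cycleType n = (evalJucysMurphy F n).coeff σ := by
  have h : ∃ τ : Perm (Fin n), τ.cycleType = σ.cycleType := ⟨σ, rfl⟩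
  rw [cycleTypeCoeff, dif_pos h]
  exact coeff_evalJucysMurphy_eq hF hk h.choose_spec

theorem coeff_evalAt_liftedJucysMurphy {F : MvPowerSeries ℕ ℤ} (hF : IsSymmetricFunction F)
    {k : ℕ} (hk : HasDegreeLE F k) {n : ℕ} {σ : Perm (Fin n)} {e : Finset (Fin n)}
    (he : σ.support ⊆ e) :
    (evalAt F (liftedJucysMurphy n) e).coeff σ = cycleTypeCoeff F σ.cycleType e.card := by
  have hι : Set.range (e.orderEmbOfFin rfl) = e := Finset.range_orderEmbOfFin e rfl
  rw [evalAt_liftedJucysMurphy_apply hF hk e (e.orderEmbOfFin rfl) hι]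
  obtain ⟨τ, rfl⟩ := Perm.exists_viaEmbedding_eq (e.orderEmbOfFin rfl).toEmbedding σ fun x hx => by
    change x ∈ Set.range (e.orderEmbOfFin rfl)
    rw [hι]
    exact he (Perm.mem_support.2 hx)
  rw [coeff_embed, Perm.cycleType_viaEmbedding, cycleTypeCoeff_cycleType hF hk]

theorem Finset.sum_filter_subset_card {α M : Type*} [Fintype α] [DecidableEq α] [AddCommMonoid M]
    (u : Finset α) (f : ℕ → M) :
    ∑ e : Finset α with u ⊆ e, f e.card =
      ∑ j ∈ Finset.range (uᶜ.card + 1), (uᶜ.card).choose j • f (u.card + j) := by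
  rw [← Finset.sum_powerset_apply_card (fun j => f (u.card + j))]
  refine Finset.sum_nbij' (· \ u) (u ∪ ·) ?_ ?_ ?_ ?_ ?_
  · intro e _
    simp only [Finset.mem_powerset]
    intro x hx
    simp only [Finset.mem_sdiff, Finset.mem_compl] at hx ⊢
    exact hx.2
  · intro e _
    simp
  · intro e he
    exact Finset.union_sdiff_of_subset (Finset.mem_filter.1 he).2
  · intro e he
    rw [Finset.mem_powerset, Finset.subset_compl_iff_disjoint_left] at he
    exact Finset.union_sdiff_cancel_left he
  · intro e he
    rw [← Finset.card_sdiff_add_card_eq_card (Finset.mem_filter.1 he).2, add_comm]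

theorem fwdDiff_iter_cycleTypeCoeff_eq_zero {F : MvPowerSeries ℕ ℤ} (hF : IsSymmetricFunction F)
    {k : ℕ} (hk : HasDegreeLE F k) {q : Multiset ℕ} (hq : ∀ a ∈ q, 2 ≤ a) {s : ℕ}
    (hs : k + Multiset.card q < q.sum + s) :
    (fwdDiff 1)^[s] (cycleTypeCoeff F q) q.sum = 0 := by
  -- With exactly s fixed points, the sets containing the support of σ are counted by the binomials
  -- of the s-th difference.
  obtain ⟨σ, hσ⟩ := (Perm.exists_with_cycleType_iff (Fin (q.sum + s)) (m := q)).2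
    ⟨by simp, hq⟩
  have hsupp : σ.support.card = q.sum := by rw [← Perm.sum_cycleType, hσ]
  have hcompl : σ.supportᶜ.card = s := by
    rw [Finset.card_compl, hsupp, Fintype.card_fin, Nat.add_sub_cancel_left]
  have h := sum_neg_one_pow_card_mul_coeff_eq_zero
    (evalAt_liftedJucysMurphy_mem hk (q.sum + s)) (σ := σ) (by rwa [hσ, Fintype.card_fin])
  rw [← Finset.sum_filter_of_ne (p := fun e => σ.support ⊆ e)] at h
  · rw [Finset.sum_congr rfl (g := fun e : Finset (Fin (q.sum + s)) =>
        (-1 : ℤ) ^ e.card * cycleTypeCoeff F q e.card) fun e he => by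
          rw [coeff_evalAt_liftedJucysMurphy hF hk (Finset.mem_filter.1 he).2, hσ],
      Finset.sum_filter_subset_card σ.support (fun j => (-1 : ℤ) ^ j * cycleTypeCoeff F q j),
      hsupp, hcompl] at h
    have h' := congrArg ((-1 : ℤ) ^ (q.sum + s) * ·) h
    simp only [mul_zero, Finset.mul_sum] at h'
    rw [fwdDiff_iter_eq_sum_shift, ← h']
    refine Finset.sum_congr rfl fun j hj => ?_
    have hj : j ≤ s := Nat.lt_succ_iff.1 (Finset.mem_range.1 hj)
    have hsign : (-1 : ℤ) ^ (q.sum + s) * (-1) ^ (q.sum + j) = (-1) ^ (s - j) := by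
      rw [← pow_add, show q.sum + s + (q.sum + j) = s - j + 2 * (q.sum + j) by omega, pow_add,
        pow_mul (-1 : ℤ) 2]
      simp
    rw [← hsign, smul_eq_mul, smul_eq_mul, mul_one, nsmul_eq_mul]
    ring
  · intro e _ he
    by_contra hne
    exact he (by rw [coeff_eq_zero_of_not_subset (evalAt_liftedJucysMurphy_mem hk _) hne, mul_zero])

/-- Newton's forward difference formula at y, truncated at d. Bounding `degree` strictly makes d = 0
force P = 0. -/
theorem exists_polynomial_of_fwdDiff_iter_eq_zero {f : ℕ → ℤ} {y d : ℕ}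
    (h : ∀ s, d ≤ s → (fwdDiff 1)^[s] f y = 0) :
    ∃ P : Polynomial ℚ, (∀ t : ℕ, (f (y + t) : ℚ) = P.eval (t : ℚ)) ∧ P.degree < d := by
  refine ⟨∑ s ∈ Finset.range d, Polynomial.C ((((fwdDiff 1)^[s] f y : ℤ) : ℚ) / s.factorial) *
    descPochhammer ℚ s, fun t => ?_, ?_⟩
  · have ht := shift_eq_sum_fwdDiff_iter 1 f t y
    rw [smul_eq_mul, mul_one] at ht
    have h1 : f (y + t) = ∑ s ∈ Finset.range d, t.choose s • (fwdDiff 1)^[s] f y := by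
      rw [ht]
      rcases le_total (t + 1) d with hd | hd
      · refine Finset.sum_subset (Finset.range_subset_range.2 hd) fun s _ hs => ?_
        rw [Nat.choose_eq_zero_of_lt (by simpa using hs), zero_smul]
      · refine (Finset.sum_subset (Finset.range_subset_range.2 hd) fun s _ hs => ?_).symm
        rw [h s (by simpa using hs), smul_zero]
    rw [h1, Polynomial.eval_finsetSum]
    push_cast
    refine Finset.sum_congr rfl fun s _ => ?_
    rw [Polynomial.eval_mul, Polynomial.eval_C, descPochhammer_eval_eq_descFactorial,
      Nat.descFactorial_eq_factorial_mul_choose]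
    have : (s.factorial : ℚ) ≠ 0 := by positivity
    push_cast
    field_simp
    simp [mul_comm]
  · rw [← Polynomial.mem_degreeLT]
    refine Submodule.sum_mem _ fun s hs => Polynomial.mem_degreeLT.2 ?_
    refine Polynomial.degree_le_natDegree.trans_lt ?_
    have := Polynomial.natDegree_C_mul_le ((((fwdDiff 1)^[s] f y : ℤ) : ℚ) / s.factorial)
      (descPochhammer ℚ s)
    rw [descPochhammer_natDegree] at this
    exact_mod_cast this.trans_lt (Finset.mem_range.1 hs)

theorem Nat.Partition.parts_eq_filter_add_replicate {n : ℕ} (lam : n.Partition) :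
    lam.parts = lam.parts.filter (2 ≤ ·) +
      Multiset.replicate (n - (lam.parts.filter (2 ≤ ·)).sum) 1 := by
  have h := Multiset.filter_add_not (2 ≤ ·) lam.parts
  have h1 : lam.parts.filter (fun a => ¬2 ≤ a) =
      Multiset.replicate (Multiset.card (lam.parts.filter (fun a => ¬2 ≤ a))) 1 := by
    refine Multiset.eq_replicate_card.2 fun a ha => ?_
    obtain ⟨ha, h2⟩ := Multiset.mem_filter.1 ha
    have := lam.parts_pos ha
    omega
  have hs := congrArg Multiset.sum h
  rw [Multiset.sum_add, lam.parts_sum, h1, Multiset.sum_replicate, smul_eq_mul, mul_one] at hs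
  rw [Nat.sub_eq_of_eq_add' hs.symm, ← h1, h]

theorem exists_perm_partition_parts_eq {n : ℕ} (lam : n.Partition) :
    ∃ σ : Perm (Fin n), σ.partition.parts = lam.parts := by
  obtain ⟨σ, hσ⟩ := (Perm.exists_with_cycleType_iff (Fin n)
    (m := lam.parts.filter (2 ≤ ·))).2 ⟨by
      rw [Fintype.card_fin]
      have h := congrArg Multiset.sum (Multiset.filter_add_not (2 ≤ ·) lam.parts)
      rw [Multiset.sum_add, lam.parts_sum] at h
      omega, fun a ha => (Multiset.mem_filter.1 ha).2⟩
  refine ⟨σ, ?_⟩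
  rw [Perm.parts_partition, ← Perm.sum_cycleType, hσ, Fintype.card_fin]
  exact lam.parts_eq_filter_add_replicate.symm

theorem coeff_classSum {n : ℕ} (lam : n.Partition) (σ : Perm (Fin n)) :
    (classSum lam).coeff σ = if σ.partition.parts = lam.parts then 1 else 0 := by
  classical
  rw [classSum, Finset.sum_filter, MonoidAlgebra.coeff_sum, Finsupp.finsetSum_apply,
    Finset.sum_eq_single σ]
  · split_ifs <;> simp
  · intro τ _ h
    split_ifs <;> simp [h]
  · simp

theorem coeff_sum_smul_classSum {n : ℕ} (b : n.Partition → ℤ) {lam : n.Partition}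
    {σ : Perm (Fin n)} (hσ : σ.partition.parts = lam.parts) :
    (∑ mu : n.Partition, b mu • classSum mu).coeff σ = b lam := by
  rw [MonoidAlgebra.coeff_sum, Finsupp.finsetSum_apply, Finset.sum_eq_single lam]
  · rw [MonoidAlgebra.coeff_smul_apply, coeff_classSum, if_pos hσ, smul_eq_mul, mul_one]
  · intro mu _ h
    rw [MonoidAlgebra.coeff_smul_apply, coeff_classSum, if_neg, smul_zero]
    rw [hσ]
    exact fun h' => h (Nat.Partition.ext h'.symm)
  · simp

/-- Class sums have disjoint nonempty supports, so comparing coefficients yields existence and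
uniqueness together. -/
theorem isClassExpansion_iff {F : MvPowerSeries ℕ ℤ} (hF : IsSymmetricFunction F) {k : ℕ}
    (hk : HasDegreeLE F k) (a : (n : ℕ) → n.Partition → ℤ) :
    IsClassExpansion F a ↔
      ∀ n lam, a n lam = cycleTypeCoeff F (lam.parts.filter (2 ≤ ·)) n := by
  have key : ∀ {n : ℕ} {lam : n.Partition} {σ : Perm (Fin n)}, σ.partition.parts = lam.parts →
      cycleTypeCoeff F (lam.parts.filter (2 ≤ ·)) n = (evalJucysMurphy F n).coeff σ := by
    intro n lam σ h
    rw [← cycleTypeCoeff_cycleType hF hk, ← h]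
    exact congrArg (cycleTypeCoeff F · n) Perm.filter_parts_partition_eq_cycleType
  refine ⟨fun h n lam => ?_, fun h n => MonoidAlgebra.ext (Finsupp.ext fun σ => ?_)⟩
  · obtain ⟨σ, hσ⟩ := exists_perm_partition_parts_eq lam
    rw [key hσ, h n, coeff_sum_smul_classSum _ hσ]
  · let lam : n.Partition := ⟨σ.partition.parts, fun h => σ.partition.parts_pos h,
      by rw [σ.partition.parts_sum, Fintype.card_fin]⟩
    rw [coeff_sum_smul_classSum (lam := lam) _ rfl, h, key rfl]

end Expansion

theorem mainTheorem6 (F : MvPowerSeries ℕ ℤ) (hF : IsSymmetricFunction F) (k : ℕ)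
    (hk : HasDegreeLE F k) :
    (∃! a : (n : ℕ) → n.Partition → ℤ, IsClassExpansion F a) ∧
    ∀ a : (n : ℕ) → n.Partition → ℤ, IsClassExpansion F a →
      ∀ (r : ℕ) (ρ : r.Partition),
        ∃ P : Polynomial ℚ,
          (∀ t : ℕ, (a (r + t) (addOnes ρ t) : ℚ) = P.eval (t : ℚ)) ∧
          (P ≠ 0 → (P.natDegree : ℤ) ≤ (k : ℤ) - ((r : ℤ) - (Multiset.card ρ.parts : ℤ))) := by
  refine ⟨⟨fun n lam => cycleTypeCoeff F (lam.parts.filter (2 ≤ ·)) n,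
    (isClassExpansion_iff hF hk _).2 fun _ _ => rfl,
    fun b hb => funext₂ ((isClassExpansion_iff hF hk b).1 hb)⟩, fun a ha r ρ => ?_⟩
  set q := ρ.parts.filter (2 ≤ ·)
  set ones := r - q.sum
  have hρ : ρ.parts = q + Multiset.replicate ones 1 := ρ.parts_eq_filter_add_replicate
  have hr : r = q.sum + ones := by
    have := congrArg Multiset.sum hρ
    rwa [ρ.parts_sum, Multiset.sum_add, Multiset.sum_replicate, smul_eq_mul, mul_one] at this
  have hcard : Multiset.card ρ.parts = Multiset.card q + ones := by
    rw [hρ, Multiset.card_add, Multiset.card_replicate]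
  -- Parts equal to 1 cancel in |ρ| − ℓ(ρ), so d is the required bound plus one; truncated
  -- subtraction gives d = 0, hence P = 0, when the bound is negative.
  obtain ⟨P, hP, hdeg⟩ := exists_polynomial_of_fwdDiff_iter_eq_zero (f := cycleTypeCoeff F q)
    (y := q.sum) (d := k + Multiset.card q + 1 - q.sum) fun s hs =>
      fwdDiff_iter_cycleTypeCoeff_eq_zero hF hk (q := q)
        (fun a ha => (Multiset.mem_filter.1 ha).2) (by omega)
  -- P counts fixed points, and ρ already has `ones` of them: hence the shift.
  refine ⟨P.comp (Polynomial.X + Polynomial.C (ones : ℚ)), fun t => ?_, fun hne => ?_⟩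
  · rw [(isClassExpansion_iff hF hk a).1 ha]
    have hfilter : (addOnes ρ t).parts.filter (2 ≤ ·) = q := by
      have h0 : (Multiset.replicate t 1).filter (2 ≤ ·) = 0 :=
        Multiset.filter_eq_nil.2 fun a h => by
          rw [Multiset.eq_of_mem_replicate h]
          decide
      rw [addOnes, Multiset.filter_add, h0, add_zero]
    have hrt : r + t = q.sum + (t + ones) := by omega
    rw [hfilter, hrt, hP]
    simp
  · have hP0 : P ≠ 0 := by
      rintro rfl
      simp at hne
    rw [Polynomial.natDegree_comp, Polynomial.natDegree_X_add_C, mul_one]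
    have := (Polynomial.natDegree_lt_iff_degree_lt hP0).2 hdeg
    omega
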